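/- Let $E,V$ be finite-dimensional real inner product spaces (e.g. $\mathbb R^n,\mathbb R^m$), $A:E\to V$ linear with operator norm $\|A\|$ and adjoint $A^\top$. Let $f:E\to(-\infty,+\infty]$ be proper, closed and $\sigma$-strongly convex with $\sigma>0$, and let $g:V\to(-\infty,+\infty]$ be proper, closed and convex. Assume that $g$ is subdifferentiable at every point of $V$ and that $\gamma_g:=\sup_{z\in V}\sup_{d\in\partial g(z)}\|d\|<\infty$. Put $$H(x)=f(x)+g(Ax),\qquad q(y)=\inf_{x,z}\{f(x)+g(z)-\langle y,Ax-z\rangle\},$$ $$F(y)=f^*(A^\top y),\quad G(y)=g^*(-y),\quad \tilde q=F+G=-q,\quad L_F=\|A\|^2/\sigma,$$ where $f^*,g^*$ are the convex conjugates, and $$Q_L(y,w)=F(w)+\langle y-w,\nabla F(w)\rangle+\tfrac L2\|y-w\|^2+G(y),\qquad p_L(w)=\operatorname*{argmin}_y Q_L(y,w),\qquad x(y)=\operatorname*{argmax}_x\{\langle A^\top y,x\rangle-f(x)\}.$$ Let $y_*$ be any maximizer of $q$. Let $0<L_0\le L_1\le L_2\le\cdots$ and let $\{y_k\}$ be generated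 by one of the following methods. * DPG: $y_k=p_{L_k}(y_{k-1})$, where $\tilde q(p_{L_k}(y_{k-1}))\le Q_{L_k}(p_{L_k}(y_{k-1}),y_{k-1})$, for $k\ge1$. * FDPG: $w_0=y_0$, $t_0=1$ and, for $k\ge1$, $y_k=p_{L_k}(w_{k-1})$, where $\tilde q(p_{L_k}(w_{k-1}))\le Q_{L_k}(p_{L_k}(w_{k-1}),w_{k-1})$, $t_k=\frac{1+\sqrt{1+4t_{k-1}^2}}2$, $w_k=y_k+\frac{t_{k-1}-1}{t_k}(y_k-y_{k-1})$. Then for every $k\ge1$ and every $L_k'\ge L_k$ with $\tilde q(p_{L_k'}(y_k))\le Q_{L_k'}(p_{L_k'}(y_k),y_k)$, the point $x(p_{L_k'}(y_k))$ exists and is unique, and $$H(x(p_{L_k'}(y_k)))-q(p_{L_k'}(y_k))\le(L_k'+L_F)\,(\|y_0-y_*\|+\|y_*\|+\gamma_g)\,\frac{2\|y_0-y_*\|}{k}.$$ The same bound holds for $H(x(p_{L_k'}(y_k)))-H(x_*)$ if $x_*$ minimizes $H$. In particular, for DPG, taking $L_k'=L_{k+1}$ (so that $p_{L_k'}(y_k)=y_{k+1}$),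 for every $k\ge1$ both $H(x(y_{k+1}))-q(y_{k+1})$ and $H(x(y_{k+1}))-H(x_*)$ are at most $$(L_{k+1}+L_F)\,(\|y_0-y_*\|+\|y_*\|+\gamma_g)\,\frac{2\|y_0-y_*\|}{k}.$$ -/

import Mathlib

noncomputable section

namespace DualProx

open Set

variable {E V : Type*} [NormedAddCommGroup E] [InnerProductSpace ℝ E] [CompleteSpace E]
  [NormedAddCommGroup V] [InnerProductSpace ℝ V] [CompleteSpace V]

/-- An extended real-valued function is proper if it never takes the value `-∞`
and is not identically `+∞`. -/
def IsProper (h : E → EReal) : Prop :=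
  (∀ x, h x ≠ ⊥) ∧ ∃ x, h x ≠ ⊤

/-- `σ`-strong convexity of an extended real-valued function (`σ = 0` is plain convexity):
`h (a x + b u) ≤ a h(x) + b h(u) - (σ/2) a b ‖x - u‖²` whenever `a, b ≥ 0`, `a + b = 1`.
The values `h x`, `h u` are read through real upper bounds, so nothing is demanded where
one of them is `+∞`. -/
def IsStronglyConvex (σ : ℝ) (h : E → EReal) : Prop :=
  ∀ (x u : E) (r s a b : ℝ), h x ≤ (r : EReal) → h u ≤ (s : EReal) →
    0 ≤ a → 0 ≤ b → a + b = 1 →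
    h (a • x + b • u) ≤ ((a * r + b * s - σ / 2 * (a * b) * ‖x - u‖ ^ 2 : ℝ) : EReal)

/-- The subdifferential `∂h(z)`. -/
def subdiff (h : E → EReal) (z : E) : Set E :=
  {d | ∀ u, h z + ((inner ℝ d (u - z) : ℝ) : EReal) ≤ h u}

/-- The convex conjugate `h^*`. -/
def conj (h : E → EReal) (u : E) : EReal :=
  ⨆ x, (((inner ℝ u x : ℝ) : EReal) - h x)

/-- The set of norms of all subgradients of `g`. -/
def subgradNorms (g : V → EReal) : Set ℝ :=
  {r | ∃ z, ∃ d ∈ subdiff g z, r = ‖d‖}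

/-- `g` is subdifferentiable everywhere and its subgradients are bounded. -/
def BoundedSubgradients (g : V → EReal) : Prop :=
  (∀ z, (subdiff g z).Nonempty) ∧ BddAbove (subgradNorms g)

/-- `γ_g`, the supremum of the norms of the subgradients of `g`. -/
def gammaG (g : V → EReal) : ℝ := sSup (subgradNorms g)

/-- The primal objective `H(x) = f(x) + g(Ax)`. -/
def primalObj (f : E → EReal) (g : V → EReal) (A : E →L[ℝ] V) (x : E) : EReal :=
  f x + g (A x)

/-- The dual function `q(y) = inf_{x,z} f(x) + g(z) - ⟨y, Ax - z⟩`. -/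
def dualFun (f : E → EReal) (g : V → EReal) (A : E →L[ℝ] V) (y : V) : EReal :=
  ⨅ (x : E) (z : V), (f x + g z - ((inner ℝ y (A x - z) : ℝ) : EReal))

/-- `F(y) = f^*(Aᵀ y)`. -/
def dualF (f : E → EReal) (A : E →L[ℝ] V) (y : V) : EReal :=
  conj f (ContinuousLinearMap.adjoint A y)

/-- `G(y) = g^*(-y)`. -/
def dualG (g : V → EReal) (y : V) : EReal := conj g (-y)

/-- `q̃ = F + G`. -/
def dualObj (f : E → EReal) (g : V → EReal) (A : E →L[ℝ] V) (y : V) : EReal :=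
  dualF f A y + dualG g y

/-- `∇F(w)`; `F` is finite and differentiable everywhere when `f` is proper, closed and
strongly convex. -/
def gradF (f : E → EReal) (A : E →L[ℝ] V) (w : V) : V :=
  gradient (fun y => (dualF f A y).toReal) w

/-- `Q_L(y, w) = F(w) + ⟨y - w, ∇F(w)⟩ + (L/2) ‖y - w‖² + G(y)`. -/
def quadModel (f : E → EReal) (g : V → EReal) (A : E →L[ℝ] V) (L : ℝ) (y w : V) : EReal :=
  dualF f A w + ((inner ℝ (y - w) (gradF f A w) + L / 2 * ‖y - w‖ ^ 2 : ℝ) : EReal) + dualG g y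

/-- `p = p_L(w)`, i.e. `p` minimizes `Q_L(·, w)`. -/
def IsProxGrad (f : E → EReal) (g : V → EReal) (A : E →L[ℝ] V) (L : ℝ) (w p : V) : Prop :=
  IsMinOn (fun y => quadModel f g A L y w) univ p

/-- The step `p = p_L(w)` together with `q̃(p_L(w)) ≤ Q_L(p_L(w), w)`. -/
def IsAcceptedStep (f : E → EReal) (g : V → EReal) (A : E →L[ℝ] V) (L : ℝ) (w p : V) : Prop :=
  IsProxGrad f g A L w p ∧ dualObj f g A p ≤ quadModel f g A L p w

/-- `x = x(y)`, i.e. `x` maximizes `⟨Aᵀ y, ·⟩ - f`. -/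
def IsPrimalPoint (f : E → EReal) (A : E →L[ℝ] V) (y : V) (x : E) : Prop :=
  IsMaxOn (fun u => ((inner ℝ (ContinuousLinearMap.adjoint A y) u : ℝ) : EReal) - f u) univ x

/-- The dual proximal gradient method, with step parameters `L k`. -/
structure IsDPG (f : E → EReal) (g : V → EReal) (A : E →L[ℝ] V) (L : ℕ → ℝ) (y : ℕ → V) :
    Prop where
  L_pos : 0 < L 0
  L_mono : ∀ k, L k ≤ L (k + 1)
  step : ∀ k, IsAcceptedStep f g A (L (k + 1)) (y k) (y (k + 1))

/-- The fast dual proximal gradient method, with step parameters `L k`. -/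
structure IsFDPG (f : E → EReal) (g : V → EReal) (A : E →L[ℝ] V) (L : ℕ → ℝ) (y w : ℕ → V)
    (t : ℕ → ℝ) : Prop where
  L_pos : 0 < L 0
  L_mono : ∀ k, L k ≤ L (k + 1)
  w_zero : w 0 = y 0
  t_zero : t 0 = 1
  step : ∀ k, IsAcceptedStep f g A (L (k + 1)) (w k) (y (k + 1))
  t_succ : ∀ k, t (k + 1) = (1 + √(1 + 4 * t k ^ 2)) / 2
  w_succ : ∀ k, w (k + 1) = y (k + 1) + ((t k - 1) / t (k + 1)) • (y (k + 1) - y k)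

/-- `L_F = ‖A‖² / σ`. -/
def lipF (A : E →L[ℝ] V) (σ : ℝ) : ℝ := ‖A‖ ^ 2 / σ

/-- `(L' + L_F) (‖y₀ - y_*‖ + ‖y_*‖ + γ_g) · 2 ‖y₀ - y_*‖ / k`. -/
def gapBound (g : V → EReal) (A : E →L[ℝ] V) (σ L' : ℝ) (y₀ ystar : V) (k : ℕ) : ℝ :=
  (L' + lipF A σ) * (‖y₀ - ystar‖ + ‖ystar‖ + gammaG g) * (2 * ‖y₀ - ystar‖ / k)

/-- The primal point `x(p)` exists and is unique, and both the primal-dual gap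
`H(x(p)) - q(p)` and the primal error `H(x(p)) - H(x_*)` are at most `B`. -/
def GapLE (f : E → EReal) (g : V → EReal) (A : E →L[ℝ] V) (p : V) (B : ℝ) : Prop :=
  (∃! x, IsPrimalPoint f A p x) ∧
  ∀ x, IsPrimalPoint f A p x →
    primalObj f g A x - dualFun f g A p ≤ (B : EReal) ∧
    ∀ xstar, IsMinOn (primalObj f g A) univ xstar →
      primalObj f g A x - primalObj f g A xstar ≤ (B : EReal)

end DualProx

end

/-!
An accepted proximal gradient step from `w` to `p` satisfies
`‖p - z‖² + (2 / L) (q̃ p - q̃ z) ≤ ‖w - z‖²` for all `z`, a discrete evolution variational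
inequality, and both convergence rates rest on this inequality alone. For the plain method,
telescoping it against the new point and against every earlier iterate, and eliminating the
unknown distances, shows that the extra step from `y k` to `p` has length at most
`2 ‖y 0 - ystar‖ / k`. For the fast method Nesterov's potential gives
`t (k - 1) ‖p - y k‖ ≤ ‖y 0 - ystar‖`, and `t (k - 1) ≥ (k + 1) / 2`.

The length of the extra step controls the primal-dual gap. Strong convexity of `f` makes the
primal point `x(y)`, characterised by `Aᵀ y ∈ ∂f(x(y))`, unique, with `y ↦ A x(y) = ∇F(y)` being
`L_F`-Lipschitz. Put `v = ∇F(w) + L (p - w)`. Optimality of the proximal step reads `-v ∈ ∂G(p)`,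
so for `x = x(p)` and `d ∈ ∂g(A x)` Fenchel's equality bounds the gap by
`⟨p + d, A x - v⟩ ≤ (‖p‖ + γ_g) (L + L_F) ‖p - w‖`. Finally `‖p‖ ≤ ‖y 0 - ystar‖ + ‖ystar‖`,
since the iterates never move away from `ystar`.
-/

namespace DualProx

open Filter Set Topology ContinuousLinearMap

section EVI

variable {M : Type*} [PseudoMetricSpace M] {q : M → ℝ} {D : Set M} {η : ℕ → ℝ} {y : ℕ → M}
  {p ystar : M} {k : ℕ} {η' : ℝ}

/-- A discrete evolution variational inequality: the only property of a proximal gradient step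
from `w` to `p` with step size `η` (the inverse of the parameter `L`) that the convergence
rates use. The objective is a real function `q` with effective domain `D`. -/
structure IsEVIStep (q : M → ℝ) (D : Set M) (η : ℝ) (w p : M) : Prop where
  mem : p ∈ D
  dist_sq_add_le : ∀ z ∈ D, dist p z ^ 2 + 2 * η * (q p - q z) ≤ dist w z ^ 2

theorem IsEVIStep.dist_le {w : M} (h : IsEVIStep q D η' w p) (hη' : 0 ≤ η')
    (hystar : ystar ∈ D) (hmin : IsMinOn q D ystar) : dist p ystar ≤ dist w ystar := by
  have hgap : 0 ≤ 2 * η' * (q p - q ystar) :=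
    mul_nonneg (by positivity) (sub_nonneg.2 (hmin h.mem))
  exact (sq_le_sq₀ dist_nonneg dist_nonneg).1 (by linarith [h.dist_sq_add_le ystar hystar])

theorem dist_sq_add_sum_le {n m : ℕ} (hnm : n ≤ m)
    (hstep : ∀ i < m, IsEVIStep q D (η i) (y i) (y (i + 1))) {z : M} (hz : z ∈ D) :
    dist (y m) z ^ 2 + 2 * ∑ i ∈ Finset.Ico n m, η i * (q (y (i + 1)) - q z) ≤
      dist (y n) z ^ 2 := by
  induction m, hnm using Nat.le_induction with
  | base => simp
  | succ m hnm ih =>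
    rw [Finset.sum_Ico_succ_top hnm]
    linarith [ih fun i hi => hstep i (hi.trans m.lt_succ_self),
      (hstep m m.lt_succ_self).dist_sq_add_le z hz]

theorem dist_le_dist_zero (hη : ∀ i, 0 ≤ η i)
    (hstep : ∀ i < k, IsEVIStep q D (η i) (y i) (y (i + 1))) (hystar : ystar ∈ D)
    (hmin : IsMinOn q D ystar) : dist (y k) ystar ≤ dist (y 0) ystar := by
  have hsum : 0 ≤ ∑ i ∈ Finset.Ico 0 k, η i * (q (y (i + 1)) - q ystar) :=
    Finset.sum_nonneg fun i hi =>
      mul_nonneg (hη i) (sub_nonneg.2 (hmin (hstep i (Finset.mem_Ico.1 hi).2).mem))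
  exact (sq_le_sq₀ dist_nonneg dist_nonneg).1
    (by linarith [dist_sq_add_sum_le k.zero_le hstep hystar])

/-- Telescope twice, once against `p` and once against `y n`: the unknown distance
`dist (y n) p` cancels. -/
theorem two_mul_sum_add_dist_sq_le {n : ℕ} (hnk : n ≤ k)
    (hstep : ∀ i < k, IsEVIStep q D (η i) (y i) (y (i + 1))) (hp : IsEVIStep q D η' (y k) p)
    (hyn : y n ∈ D) :
    2 * ∑ i ∈ Finset.Ico n k, η i * (q (y (i + 1)) - q p) + dist (y k) p ^ 2 / 2 ≤
      (q (y n) - q p) * (∑ i ∈ Finset.Ico n k, η i + η') := by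
  have against_p := dist_sq_add_sum_le hnk hstep hp.mem
  have against_yn := dist_sq_add_sum_le hnk hstep hyn
  have last_step := hp.dist_sq_add_le (y n) hyn
  have split_sum : ∑ i ∈ Finset.Ico n k, η i * (q (y (i + 1)) - q (y n)) =
      ∑ i ∈ Finset.Ico n k, η i * (q (y (i + 1)) - q p) -
        (q (y n) - q p) * ∑ i ∈ Finset.Ico n k, η i := by
    rw [Finset.mul_sum, ← Finset.sum_sub_distrib]
    exact Finset.sum_congr rfl fun i _ => by ring
  rw [split_sum, dist_self] at against_yn
  rw [dist_comm p] at last_step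
  linarith

theorem two_mul_sum_add_dist_sq_le_mul (hη : Antitone η) (hη' : 0 < η')
    (hη'_le : ∀ i < k, η' ≤ η i) {n : ℕ} (hnk : n < k)
    (hstep : ∀ i < k, IsEVIStep q D (η i) (y i) (y (i + 1))) (hp : IsEVIStep q D η' (y k) p)
    (hsum : 0 ≤ ∑ i ∈ Finset.Ico (n + 1) k, η i * (q (y (i + 1)) - q p)) :
    2 * ∑ i ∈ Finset.Ico (n + 1) k, η i * (q (y (i + 1)) - q p) + dist (y k) p ^ 2 / 2 ≤
      (k - n) * (η n * (q (y (n + 1)) - q p)) := by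
  have window := two_mul_sum_add_dist_sq_le hnk hstep hp (hstep n hnk).mem
  have total_pos : 0 < ∑ i ∈ Finset.Ico (n + 1) k, η i + η' :=
    add_pos_of_nonneg_of_pos
      (Finset.sum_nonneg fun i hi => hη'.le.trans (hη'_le i (Finset.mem_Ico.1 hi).2)) hη'
  have total_le : ∑ i ∈ Finset.Ico (n + 1) k, η i + η' ≤ (k - n) * η n := by
    have := Finset.sum_le_card_nsmul (Finset.Ico (n + 1) k) η (η n) fun i hi =>
      hη (n.le_succ.trans (Finset.mem_Ico.1 hi).1)
    rw [Nat.card_Ico, nsmul_eq_mul, Nat.cast_sub hnk] at this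
    push_cast at this
    linarith [hη'_le n hnk]
  have decrease : 0 ≤ q (y (n + 1)) - q p :=
    nonneg_of_mul_nonneg_left (le_trans (by positivity) window) total_pos
  linarith [mul_le_mul_of_nonneg_left total_le decrease]

/-- With `W n` the sum on the right and `s = dist (y k) p ^ 2`, the previous estimate reads
`W n ≥ W (n + 1) + (2 * W (n + 1) + s / 2) / (k - n)`; the left-hand side solves the recurrence
with equality. -/
theorem dist_sq_mul_le_sum (hη : Antitone η) (hη' : 0 < η') (hη'_le : ∀ i < k, η' ≤ η i)
    (hstep : ∀ i < k, IsEVIStep q D (η i) (y i) (y (i + 1))) (hp : IsEVIStep q D η' (y k) p)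
    {n : ℕ} (hnk : n ≤ k) :
    dist (y k) p ^ 2 * ((k - n) * (k - n + 3)) / 8 ≤
      ∑ i ∈ Finset.Ico n k, η i * (q (y (i + 1)) - q p) := by
  induction hnk using Nat.decreasingInduction with
  | self => simp
  | of_succ n hnk ih =>
    have hkn : (1 : ℝ) ≤ k - n := by
      rw [le_sub_iff_add_le']
      exact_mod_cast hnk
    push_cast at ih
    have hsum := le_trans (div_nonneg (mul_nonneg (sq_nonneg _)
      (mul_nonneg (by linarith) (by linarith))) (by norm_num)) ih
    have recurrence := two_mul_sum_add_dist_sq_le_mul hη hη' hη'_le hnk hstep hp hsum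
    rw [Finset.sum_eq_sum_Ico_succ_bot hnk]
    refine le_of_mul_le_mul_left ?_ (by linarith : (0 : ℝ) < k - n)
    linarith [mul_le_mul_of_nonneg_left ih (by linarith : (0 : ℝ) ≤ k - n + 2)]

theorem dist_le_two_mul_dist_div (hη : Antitone η) (hη' : 0 < η') (hη'_le : ∀ i < k, η' ≤ η i)
    (hk : 1 ≤ k) (hstep : ∀ i < k, IsEVIStep q D (η i) (y i) (y (i + 1)))
    (hp : IsEVIStep q D η' (y k) p) (hystar : ystar ∈ D) (hmin : IsMinOn q D ystar) :
    dist (y k) p ≤ 2 * dist (y 0) ystar / k := by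
  have lower := dist_sq_mul_le_sum hη hη' hη'_le hstep hp k.zero_le
  have upper := dist_sq_add_sum_le k.zero_le hstep hystar
  have compare : ∑ i ∈ Finset.Ico 0 k, η i * (q (y (i + 1)) - q p) ≤
      ∑ i ∈ Finset.Ico 0 k, η i * (q (y (i + 1)) - q ystar) :=
    Finset.sum_le_sum fun i hi => mul_le_mul_of_nonneg_left (sub_le_sub_left (hmin hp.mem) _)
      (hη'.le.trans (hη'_le i (Finset.mem_Ico.1 hi).2))
  have hk0 : (0 : ℝ) < k := by exact_mod_cast hk
  rw [le_div_iff₀ hk0, ← sq_le_sq₀ (by positivity) (by positivity), mul_pow, mul_pow]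
  rw [Nat.cast_zero, sub_zero] at lower
  have drop : 0 ≤ dist (y k) p ^ 2 * k := by positivity
  linarith [sq_nonneg (dist (y k) ystar)]

end EVI

section Accelerated

variable {V : Type*} [SeminormedAddCommGroup V] [InnerProductSpace ℝ V]

theorem mul_norm_sub_sq_add_mul_norm_sq (a b : V) (T : ℝ) :
    T * (T - 1) * ‖a - b‖ ^ 2 + T * ‖a‖ ^ 2 =
      ‖T • a - (T - 1) • b‖ ^ 2 + (T - 1) * ‖b‖ ^ 2 := by
  simp only [norm_sub_sq_real, norm_smul, real_inner_smul_left, real_inner_smul_right, mul_pow,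
    Real.norm_eq_abs, sq_abs]
  ring

variable {q : V → ℝ} {D : Set V} {η t : ℕ → ℝ} {y w : ℕ → V} {ystar : V}

theorem IsEVIStep.norm_extrapolation_sq_le {η T : ℝ} {w p b z : V} (h : IsEVIStep q D η w p)
    (hT : 1 ≤ T) (hb : b ∈ D) (hz : z ∈ D) :
    ‖T • (p - z) - (T - 1) • (b - z)‖ ^ 2 +
        2 * η * (T ^ 2 * (q p - q z) - T * (T - 1) * (q b - q z)) ≤
      ‖T • (w - z) - (T - 1) • (b - z)‖ ^ 2 := by
  have at_b := mul_le_mul_of_nonneg_left (h.dist_sq_add_le b hb)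
    (mul_nonneg (by linarith) (by linarith) : 0 ≤ T * (T - 1))
  have at_z := mul_le_mul_of_nonneg_left (h.dist_sq_add_le z hz) (by linarith : 0 ≤ T)
  have identity_p := mul_norm_sub_sq_add_mul_norm_sq (p - z) (b - z) T
  have identity_w := mul_norm_sub_sq_add_mul_norm_sq (w - z) (b - z) T
  rw [sub_sub_sub_cancel_right] at identity_p identity_w
  simp only [dist_eq_norm] at at_b at_z
  linarith

/-- Nesterov-accelerated iteration, with each step replaced by its evolution variational
inequality; it abstracts the fast dual proximal gradient method. -/
structure IsAccelerated (q : V → ℝ) (D : Set V) (η : ℕ → ℝ) (y w : ℕ → V) (t : ℕ → ℝ) :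
    Prop where
  w_zero : w 0 = y 0
  t_zero : t 0 = 1
  step : ∀ k, IsEVIStep q D (η k) (w k) (y (k + 1))
  t_succ : ∀ k, t (k + 1) = (1 + √(1 + 4 * t k ^ 2)) / 2
  w_succ : ∀ k, w (k + 1) = y (k + 1) + ((t k - 1) / t (k + 1)) • (y (k + 1) - y k)

namespace IsAccelerated

theorem momentum_mul_sub_one (h : IsAccelerated q D η y w t) (k : ℕ) :
    t (k + 1) * (t (k + 1) - 1) = t k ^ 2 := by
  rw [h.t_succ]
  linarith [Real.sq_sqrt (show 0 ≤ 1 + 4 * t k ^ 2 by positivity)]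

theorem add_two_div_two_le_momentum (h : IsAccelerated q D η y w t) (k : ℕ) :
    ((k : ℝ) + 2) / 2 ≤ t k := by
  induction k with
  | zero => simp [h.t_zero]
  | succ k ih =>
    have two_mul_le_sqrt : 2 * t k ≤ √(1 + 4 * t k ^ 2) := Real.le_sqrt_of_sq_le (by linarith)
    rw [h.t_succ]
    push_cast
    linarith

theorem one_le_momentum (h : IsAccelerated q D η y w t) (k : ℕ) : 1 ≤ t k := by
  linarith [h.add_two_div_two_le_momentum k, k.cast_nonneg (α := ℝ)]

theorem momentum_smul_extrapolated_sub (h : IsAccelerated q D η y w t) (k : ℕ) (z : V) :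
    t (k + 1) • (w (k + 1) - z) - (t (k + 1) - 1) • (y (k + 1) - z) =
      t k • (y (k + 1) - z) - (t k - 1) • (y k - z) := by
  have smul_w : t (k + 1) • w (k + 1) =
      t (k + 1) • y (k + 1) + (t k - 1) • (y (k + 1) - y k) := by
    rw [h.w_succ, smul_add, smul_smul,
      mul_div_cancel₀ _ (zero_lt_one.trans_le (h.one_le_momentum (k + 1))).ne']
  rw [smul_sub, smul_w]
  module

theorem gap_nonneg (h : IsAccelerated q D η y w t) (hmin : IsMinOn q D ystar) (k : ℕ) :
    0 ≤ q (y (k + 1)) - q ystar := sub_nonneg.2 (hmin (h.step k).mem)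

theorem potential_le (h : IsAccelerated q D η y w t) (hη : Antitone η) (hystar : ystar ∈ D)
    (hmin : IsMinOn q D ystar) (k : ℕ) :
    2 * t k ^ 2 * (η k * (q (y (k + 1)) - q ystar)) +
      ‖t k • (y (k + 1) - ystar) - (t k - 1) • (y k - ystar)‖ ^ 2 ≤ ‖y 0 - ystar‖ ^ 2 := by
  induction k with
  | zero =>
    have first_step := (h.step 0).dist_sq_add_le ystar hystar
    rw [h.w_zero, dist_eq_norm, dist_eq_norm] at first_step
    simp only [h.t_zero, one_smul, sub_self, zero_smul, sub_zero]
    linarith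
  | succ k ih =>
    have extrapolation := (h.step (k + 1)).norm_extrapolation_sq_le (h.one_le_momentum (k + 1))
      (h.step k).mem hystar
    rw [h.momentum_smul_extrapolated_sub, h.momentum_mul_sub_one] at extrapolation
    have step_anti := mul_le_mul_of_nonneg_left
      (mul_le_mul_of_nonneg_right (hη k.le_succ) (h.gap_nonneg hmin k))
      (by positivity : 0 ≤ 2 * t k ^ 2)
    linarith

theorem norm_sub_le (h : IsAccelerated q D η y w t) (hη : Antitone η) (hη0 : ∀ i, 0 ≤ η i)
    (hystar : ystar ∈ D) (hmin : IsMinOn q D ystar) (k : ℕ) :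
    ‖y k - ystar‖ ≤ ‖y 0 - ystar‖ := by
  induction k with
  | zero => exact le_rfl
  | succ k ih =>
    have ht := h.one_le_momentum k
    set u := t k • (y (k + 1) - ystar) - (t k - 1) • (y k - ystar) with hu
    have gap_term : 0 ≤ 2 * t k ^ 2 * (η k * (q (y (k + 1)) - q ystar)) :=
      mul_nonneg (by positivity) (mul_nonneg (hη0 k) (h.gap_nonneg hmin k))
    have norm_u : ‖u‖ ≤ ‖y 0 - ystar‖ := (sq_le_sq₀ (norm_nonneg _) (norm_nonneg _)).1
      (by linarith [h.potential_le hη hystar hmin k])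
    have triangle : t k * ‖y (k + 1) - ystar‖ ≤ ‖u‖ + (t k - 1) * ‖y k - ystar‖ := by
      have := norm_add_le u ((t k - 1) • (y k - ystar))
      rwa [hu, sub_add_cancel, ← hu, norm_smul, norm_smul, Real.norm_of_nonneg (by linarith),
        Real.norm_of_nonneg (by linarith)] at this
    have := mul_le_mul_of_nonneg_left ih (by linarith : 0 ≤ t k - 1)
    exact le_of_mul_le_mul_left (by linarith) (by linarith : 0 < t k)

theorem momentum_mul_norm_sub_le (h : IsAccelerated q D η y w t) (hη : Antitone η)
    (hystar : ystar ∈ D) (hmin : IsMinOn q D ystar) {k : ℕ} {η' : ℝ} (hη' : 0 ≤ η')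
    (hη'_le : η' ≤ η k) {p : V} (hp : IsEVIStep q D η' (y (k + 1)) p) :
    t k * ‖p - y (k + 1)‖ ≤ ‖y 0 - ystar‖ := by
  have last_step := hp.dist_sq_add_le (y (k + 1)) (h.step k).mem
  rw [dist_self, dist_eq_norm] at last_step
  have decrease_le : η' * (q (y (k + 1)) - q p) ≤ η k * (q (y (k + 1)) - q ystar) :=
    (mul_le_mul_of_nonneg_left (sub_le_sub_left (hmin hp.mem) _) hη').trans
      (mul_le_mul_of_nonneg_right hη'_le (h.gap_nonneg hmin k))
  have norm_sq_le : ‖p - y (k + 1)‖ ^ 2 ≤ 2 * (η k * (q (y (k + 1)) - q ystar)) := by linarith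
  have ht : 0 ≤ t k := zero_le_one.trans (h.one_le_momentum k)
  rw [← sq_le_sq₀ (by positivity) (norm_nonneg _), mul_pow]
  linarith [h.potential_le hη hystar hmin k,
    mul_le_mul_of_nonneg_left norm_sq_le (sq_nonneg (t k)),
    sq_nonneg ‖t k • (y (k + 1) - ystar) - (t k - 1) • (y k - ystar)‖]

end IsAccelerated

end Accelerated

section ConvexFunctions

theorem IsProper.exists_eq_coe {H : Type*} {h : H → EReal} {x : H} (hp : IsProper h)
    (hx : h x ≠ ⊤) : ∃ r : ℝ, h x = r :=
  ⟨_, (EReal.coe_toReal hx (hp.1 x)).symm⟩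

theorem IsProper.isMinOn_toReal {H : Type*} {h : H → EReal} {x : H} (hh : IsProper h)
    (hmin : IsMinOn h univ x) :
    x ∈ {z | h z ≠ ⊤} ∧ IsMinOn (fun z => (h z).toReal) {z | h z ≠ ⊤} x := by
  refine ⟨?_, fun z hz => EReal.toReal_le_toReal (hmin (mem_univ z)) (hh.1 x) hz⟩
  obtain ⟨z, hz⟩ := hh.2
  exact ne_top_of_le_ne_top hz (hmin (mem_univ z))

variable {H : Type*} [NormedAddCommGroup H] [InnerProductSpace ℝ H] {h : H → EReal} {σ : ℝ}
  {x x' z c c' d u v w p : H}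

theorem IsProper.ne_top_of_mem_subdiff (hp : IsProper h) (hd : d ∈ subdiff h z) : h z ≠ ⊤ := by
  intro htop
  obtain ⟨u, hu⟩ := hp.2
  exact hu (top_le_iff.1 (by simpa [htop] using hd u))

theorem IsProper.exists_eq_coe_of_mem_subdiff (hp : IsProper h) (hd : d ∈ subdiff h z) :
    ∃ r : ℝ, h z = r :=
  hp.exists_eq_coe (hp.ne_top_of_mem_subdiff hd)

theorem isMaxOn_inner_sub_iff :
    IsMaxOn (fun u => ((inner ℝ c u : ℝ) : EReal) - h u) univ x ↔ c ∈ subdiff h x := by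
  have key (a b : EReal) (r s : ℝ) : (s : EReal) - b ≤ r - a ↔ a + ((s - r : ℝ) : EReal) ≤ b := by
    induction a <;> induction b
    case coe.coe => norm_cast; constructor <;> intro <;> linarith
    all_goals simp [← EReal.coe_sub]
  simp only [isMaxOn_iff, mem_univ, forall_const, subdiff, mem_ofPred_eq, inner_sub_right, key]

theorem isMinOn_sub_inner_iff :
    IsMinOn (fun u => h u - ((inner ℝ c u : ℝ) : EReal)) univ x ↔ c ∈ subdiff h x := by
  have key (a b : EReal) (r s : ℝ) : a - (r : EReal) ≤ b - s ↔ a + ((s - r : ℝ) : EReal) ≤ b := by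
    induction a <;> induction b
    case coe.coe => norm_cast; constructor <;> intro <;> linarith
    all_goals simp [← EReal.coe_sub]
  simp only [isMinOn_iff, mem_univ, forall_const, subdiff, mem_ofPred_eq, inner_sub_right, key]

theorem IsStronglyConvex.add_coe (hh : IsStronglyConvex σ h) {k : H → ℝ}
    (hk : ConvexOn ℝ univ k) : IsStronglyConvex σ fun x => h x + (k x : EReal) := by
  intro x u r s a b hx hu ha hb hab
  have h_le {y : H} {t : ℝ} (hy : h y + (k y : EReal) ≤ t) : h y ≤ ((t - k y : ℝ) : EReal) := by
    rw [EReal.coe_sub]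
    exact EReal.le_sub_iff_add_le (.inl (by simp)) (.inl (by simp)) |>.2 hy
  have hk_le := hk.2 (mem_univ x) (mem_univ u) ha hb hab
  calc h (a • x + b • u) + (k (a • x + b • u) : EReal)
      ≤ ((a * (r - k x) + b * (s - k u) - σ / 2 * (a * b) * ‖x - u‖ ^ 2 : ℝ) : EReal)
          + ((a * k x + b * k u : ℝ) : EReal) :=
        add_le_add (hh x u _ _ a b (h_le hx) (h_le hu) ha hb hab) (EReal.coe_le_coe_iff.2 hk_le)
    _ = _ := by
        rw [← EReal.coe_add]
        congr 1
        ring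

theorem IsStronglyConvex.add_coe_le_of_mem_subdiff (hh : IsStronglyConvex σ h)
    (hd : d ∈ subdiff h x) (u : H) :
    h x + ((inner ℝ d (u - x) + σ / 2 * ‖u - x‖ ^ 2 : ℝ) : EReal) ≤ h u := by
  induction hx : h x with
  | bot => simp
  | top =>
    have hu : h u = ⊤ := by simpa [hx] using hd u
    simp [hu]
  | coe r =>
    induction hu : h u with
    | bot => simpa [hx, hu, ← EReal.coe_add] using hd u
    | top => exact le_top
    | coe s =>
      have hseg : ∀ b ∈ Ioo (0 : ℝ) 1,
          r + inner ℝ d (u - x) + σ / 2 * (1 - b) * ‖u - x‖ ^ 2 ≤ s := by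
        rintro b ⟨hb0, hb1⟩
        have hlow := hd ((1 - b) • x + b • u)
        have hup := hh x u r s (1 - b) b hx.le hu.le (by linarith) hb0.le (by ring)
        rw [show (1 - b) • x + b • u - x = b • (u - x) by module, inner_smul_right, hx,
          ← EReal.coe_add] at hlow
        have hle := EReal.coe_le_coe_iff.1 (hlow.trans hup)
        rw [norm_sub_rev x u] at hle
        refine le_of_mul_le_mul_left ?_ hb0
        linarith
      rw [← EReal.coe_add, EReal.coe_le_coe_iff]
      have hlim : Tendsto (fun b : ℝ => r + inner ℝ d (u - x) + σ / 2 * (1 - b) * ‖u - x‖ ^ 2)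
          (𝓝[>] 0) (𝓝 (r + inner ℝ d (u - x) + σ / 2 * (1 - 0) * ‖u - x‖ ^ 2)) :=
        (Continuous.tendsto (by fun_prop) 0).mono_left nhdsWithin_le_nhds
      have hle := le_of_tendsto hlim (eventually_of_mem (Ioo_mem_nhdsGT one_pos) hseg)
      linarith

theorem IsStronglyConvex.mul_norm_sub_le (hh : IsStronglyConvex σ h) (hp : IsProper h)
    (hc : c ∈ subdiff h x) (hc' : c' ∈ subdiff h x') : σ * ‖x - x'‖ ≤ ‖c - c'‖ := by
  obtain ⟨r, hr⟩ := hp.exists_eq_coe_of_mem_subdiff hc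
  obtain ⟨s, hs⟩ := hp.exists_eq_coe_of_mem_subdiff hc'
  have hle := hh.add_coe_le_of_mem_subdiff hc x'
  have hle' := hh.add_coe_le_of_mem_subdiff hc' x
  rw [hr, hs, ← EReal.coe_add, EReal.coe_le_coe_iff] at hle hle'
  have hmono : σ * ‖x - x'‖ ^ 2 ≤ inner ℝ (c - c') (x - x') := by
    rw [norm_sub_rev x' x, ← neg_sub x x', inner_neg_right] at hle
    rw [inner_sub_left]
    linarith
  rcases (norm_nonneg (x - x')).eq_or_lt with h0 | hpos
  · simp [← h0]
  · refine le_of_mul_le_mul_right ?_ hpos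
    linarith [real_inner_le_norm (c - c') (x - x')]

theorem IsStronglyConvex.eq_of_mem_subdiff (hσ : 0 < σ) (hh : IsStronglyConvex σ h)
    (hp : IsProper h) (hc : c ∈ subdiff h x) (hc' : c ∈ subdiff h x') : x = x' := by
  have hle := hh.mul_norm_sub_le hp hc hc'
  rw [sub_self, norm_zero] at hle
  exact sub_eq_zero.1 (norm_le_zero_iff.1 (nonpos_of_mul_nonpos_right hle hσ))

theorem IsStronglyConvex.quadratic_growth_of_lt_on_ball (hσ : 0 ≤ σ) (hh : IsStronglyConvex σ h)
    {r s δ : ℝ} (hδ : 0 < δ) (hu : h u ≤ r)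
    (hball : ∀ z, dist z u < δ → ((r - 1 : ℝ) : EReal) < h z) (hfar : δ ≤ ‖x - u‖)
    (hx : h x ≤ s) : r - 2 * ‖x - u‖ / δ + σ / 4 * ‖x - u‖ ^ 2 ≤ s := by
  generalize hρ : ‖x - u‖ = ρ at hfar ⊢
  have hρ0 : 0 < ρ := hδ.trans_le hfar
  obtain ⟨t, ht⟩ : ∃ t, t = δ / (2 * ρ) := ⟨_, rfl⟩
  have ht0 : 0 < t := by rw [ht]; positivity
  have htρ : t * ρ = δ / 2 := by rw [ht]; field_simp
  have ht1 : t ≤ 1 / 2 := le_of_mul_le_mul_right (by linarith) hρ0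
  have hmid : dist ((1 - t) • u + t • x) u < δ := by
    rw [dist_eq_norm, show (1 - t) • u + t • x - u = t • (x - u) by module, norm_smul,
      Real.norm_of_nonneg ht0.le, hρ]
    linarith
  have hlt := EReal.coe_lt_coe_iff.1 <| (hball _ hmid).trans_le <|
    hh u x r s (1 - t) t hu hx (by linarith) ht0.le (by ring)
  rw [norm_sub_rev, hρ] at hlt
  refine le_of_mul_le_mul_left ?_ ht0
  have hcancel : t * (2 * ρ / δ) = 1 := by rw [ht]; field_simp
  have hdrop : 0 ≤ σ * t * ρ ^ 2 * (1 / 2 - t) :=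
    mul_nonneg (by positivity) (sub_nonneg.2 ht1)
  linear_combination hlt - hcancel + hdrop / 2

theorem IsStronglyConvex.exists_coe_le (hσ : 0 < σ) (hh : IsStronglyConvex σ h)
    (hp : IsProper h) (hlsc : LowerSemicontinuous h) : ∃ m : ℝ, ∀ x, (m : EReal) ≤ h x := by
  obtain ⟨u, hu⟩ := hp.2
  obtain ⟨r, hr⟩ := hp.exists_eq_coe hu
  have hlt : ((r - 1 : ℝ) : EReal) < h u := by
    rw [hr, EReal.coe_lt_coe_iff]
    exact sub_one_lt r
  obtain ⟨δ, hδ, hball⟩ := Metric.eventually_nhds_iff.1 (hlsc u _ hlt)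
  have hm : 0 ≤ 4 / (σ * δ ^ 2) := by positivity
  refine ⟨r - 1 - 4 / (σ * δ ^ 2), fun x => ?_⟩
  by_cases hnear : dist x u < δ
  · exact (EReal.coe_le_coe_iff.2 (by linarith)).trans (hball hnear).le
  induction hx : h x with
  | bot => exact absurd hx (hp.1 x)
  | top => exact le_top
  | coe s =>
    rw [EReal.coe_le_coe_iff]
    have hgrowth := hh.quadratic_growth_of_lt_on_ball hσ.le hδ hr.le (fun _ hz => hball hz)
      (dist_eq_norm x u ▸ not_lt.1 hnear) hx.le
    have hsq : 0 ≤ (σ * δ * ‖x - u‖ - 4) ^ 2 / (4 * σ * δ ^ 2) := by positivity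
    have hexpand : (σ * δ * ‖x - u‖ - 4) ^ 2 / (4 * σ * δ ^ 2) =
        σ / 4 * ‖x - u‖ ^ 2 - 2 * ‖x - u‖ / δ + 4 / (σ * δ ^ 2) := by
      field_simp
      ring
    linarith

theorem IsStronglyConvex.mul_norm_sub_sq_le (hh : IsStronglyConvex σ h) {m ε : ℝ}
    (hm : ∀ x, (m : EReal) ≤ h x) (hx : h x ≤ ((m + ε : ℝ) : EReal))
    (hu : h u ≤ ((m + ε : ℝ) : EReal)) : σ * ‖x - u‖ ^ 2 ≤ 8 * ε := by
  have hmid := EReal.coe_le_coe_iff.1 <| (hm _).trans <|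
    hh x u _ _ (1 / 2) (1 / 2) hx hu (by norm_num) (by norm_num) (by norm_num)
  linarith

theorem IsStronglyConvex.exists_isMinOn [CompleteSpace H] (hσ : 0 < σ)
    (hh : IsStronglyConvex σ h) (hp : IsProper h) (hlsc : LowerSemicontinuous h) :
    ∃ x, IsMinOn h univ x := by
  obtain ⟨b, hb⟩ := hh.exists_coe_le hσ hp hlsc
  obtain ⟨m, hm⟩ : ∃ m : ℝ, ⨅ x, h x = m := by
    refine ⟨_, (EReal.coe_toReal ?_ ?_).symm⟩
    · obtain ⟨x, hx⟩ := hp.2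
      exact ne_top_of_le_ne_top hx (iInf_le h x)
    · exact ne_bot_of_le_ne_bot (EReal.coe_ne_bot b) (le_iInf hb)
  have hm_le (x : H) : (m : EReal) ≤ h x := hm ▸ iInf_le h x
  have happrox (n : ℕ) : ∃ x, h x < ((m + 1 / (n + 1) : ℝ) : EReal) := by
    rw [← iInf_lt_iff, hm, EReal.coe_lt_coe_iff]
    linarith [Nat.one_div_pos_of_nat (α := ℝ) (n := n)]
  choose u hu using happrox
  have hu_le {N n : ℕ} (hn : N ≤ n) : h (u n) ≤ ((m + 1 / (N + 1) : ℝ) : EReal) :=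
    (hu n).le.trans <| EReal.coe_le_coe_iff.2 <|
      add_le_add_right (Nat.one_div_le_one_div hn) m
  have hcauchy : CauchySeq u := by
    refine cauchySeq_of_le_tendsto_0 (fun N : ℕ => √(8 * (1 / ((N : ℝ) + 1)) / σ))
      (fun n k N hn hk => ?_) ?_
    · rw [dist_eq_norm]
      refine Real.le_sqrt_of_sq_le ((le_div_iff₀ hσ).2 ?_)
      linarith [hh.mul_norm_sub_sq_le hm_le (hu_le hn) (hu_le hk)]
    · have hlim := tendsto_one_div_add_atTop_nhds_zero_nat (𝕜 := ℝ)
      simpa using ((hlim.const_mul 8).div_const σ).sqrt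
  obtain ⟨x, hx⟩ := cauchySeq_tendsto_of_complete hcauchy
  refine ⟨x, fun z _ => le_trans ?_ (hm_le z)⟩
  have hx_le (N : ℕ) : h x ≤ ((m + 1 / (N + 1) : ℝ) : EReal) :=
    (hlsc.isClosed_preimage _).mem_of_tendsto hx
      ((eventually_ge_atTop N).mono fun n hn => hu_le hn)
  have hlim : Tendsto (fun N : ℕ => ((m + 1 / (N + 1) : ℝ) : EReal)) atTop (𝓝 m) :=
    EReal.tendsto_coe.2 <| by
      simpa using (tendsto_one_div_add_atTop_nhds_zero_nat (𝕜 := ℝ)).const_add m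
  exact ge_of_tendsto' hlim hx_le

theorem IsStronglyConvex.exists_mem_subdiff [CompleteSpace H] (hσ : 0 < σ)
    (hh : IsStronglyConvex σ h) (hp : IsProper h) (hlsc : LowerSemicontinuous h) (c : H) :
    ∃ x, c ∈ subdiff h x := by
  have hconv : ConvexOn ℝ univ fun u : H => inner ℝ (-c) u :=
    (innerSL ℝ (-c)).toLinearMap.convexOn convex_univ
  have hlsc' : LowerSemicontinuous fun u => h u + ((inner ℝ (-c) u : ℝ) : EReal) :=
    hlsc.add' (continuous_coe_real_ereal.comp (by fun_prop)).lowerSemicontinuous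
      fun u => EReal.continuousAt_add (by simp) (by simp)
  have hp' : IsProper fun u => h u + ((inner ℝ (-c) u : ℝ) : EReal) :=
    ⟨fun u => by simpa [EReal.add_eq_bot_iff] using hp.1 u,
      hp.2.imp fun u hu => EReal.add_ne_top hu (EReal.coe_ne_top _)⟩
  obtain ⟨x, hx⟩ := (hh.add_coe hconv).exists_isMinOn hσ hp' hlsc'
  refine ⟨x, isMinOn_sub_inner_iff.1 ?_⟩
  simpa only [inner_neg_left, EReal.coe_neg, ← sub_eq_add_neg] using hx

theorem IsStronglyConvex.neg_mem_subdiff_of_isMinOn_add [CompleteSpace H]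
    (hh : IsStronglyConvex 0 h) {k : H → ℝ} (hk : HasGradientAt k d p)
    (hmin : IsMinOn (fun u => h u + (k u : EReal)) univ p) : -d ∈ subdiff h p := by
  intro u
  have hle (v : H) : h p + (k p : EReal) ≤ h v + (k v : EReal) := hmin (mem_univ v)
  induction hx : h p with
  | bot => simp
  | top =>
    have hu : h u = ⊤ := by
      by_contra hu
      exact EReal.add_ne_top hu (EReal.coe_ne_top _) (top_le_iff.1 (by simpa [hx] using hle u))
    simp [hu]
  | coe r =>
    induction hu : h u with
    | bot => simpa [hx, hu, ← EReal.coe_add] using hle u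
    | top => exact le_top
    | coe s =>
      have hslope : ∀ b ∈ Ioo (0 : ℝ) 1, r - s ≤ b⁻¹ • (k (p + b • (u - p)) - k p) := by
        rintro b ⟨hb0, hb1⟩
        have hseg := (hle _).trans <| add_le_add_left
          (hh p u r s (1 - b) b hx.le hu.le (by linarith) hb0.le (by ring)) _
        rw [hx, show (1 - b) • p + b • u = p + b • (u - p) by module, ← EReal.coe_add,
          ← EReal.coe_add, EReal.coe_le_coe_iff] at hseg
        rw [smul_eq_mul, inv_mul_eq_div, le_div_iff₀ hb0]
        linarith
      have hlim := (hk.hasFDerivAt.hasLineDerivAt (u - p)).tendsto_slope_zero_right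
      have := ge_of_tendsto hlim (eventually_of_mem (Ioo_mem_nhdsGT one_pos) hslope)
      rw [InnerProductSpace.toDual_apply_apply] at this
      rw [inner_neg_left, ← EReal.coe_add, EReal.coe_le_coe_iff]
      linarith

theorem conj_ne_bot (hh : ∃ x, h x ≠ ⊤) (c : H) : conj h c ≠ ⊥ := by
  obtain ⟨x, hx⟩ := hh
  refine ne_bot_of_le_ne_bot ?_ (le_iSup (fun x => ((inner ℝ c x : ℝ) : EReal) - h x) x)
  simpa [sub_eq_add_neg, EReal.add_eq_bot_iff] using hx

theorem inner_sub_le_conj (c u : H) : ((inner ℝ c u : ℝ) : EReal) - h u ≤ conj h c :=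
  le_iSup (fun x => ((inner ℝ c x : ℝ) : EReal) - h x) u

theorem conj_eq_of_mem_subdiff (hd : d ∈ subdiff h x) :
    conj h d = ((inner ℝ d x : ℝ) : EReal) - h x :=
  le_antisymm (iSup_le fun _ => isMaxOn_inner_sub_iff.2 hd (mem_univ _)) (inner_sub_le_conj d x)

theorem mem_subdiff_conj (hd : d ∈ subdiff h x) : x ∈ subdiff (conj h) d := by
  intro c
  rw [conj_eq_of_mem_subdiff hd]
  refine le_trans (le_of_eq ?_) (inner_sub_le_conj c x)
  rw [inner_sub_right, real_inner_comm, real_inner_comm c]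
  induction h x <;> simp [← EReal.coe_sub, ← EReal.coe_add]

theorem IsProper.conj (hp : IsProper h) (hd : d ∈ subdiff h x) : IsProper (conj h) := by
  refine ⟨conj_ne_bot hp.2, d, ?_⟩
  obtain ⟨r, hr⟩ := hp.exists_eq_coe_of_mem_subdiff hd
  rw [conj_eq_of_mem_subdiff hd, hr, ← EReal.coe_sub]
  exact EReal.coe_ne_top _

theorem conj_add_le_of_mem_subdiff (hd : d ∈ subdiff h v) (hv : v ∈ subdiff (conj h) u) :
    conj h u + h v ≤ ((inner ℝ u v : ℝ) : EReal) := by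
  have key (a b : EReal) (r s : ℝ) : a + ((r - s : ℝ) : EReal) ≤ r - b ↔ a + b ≤ s := by
    induction a <;> induction b
    case coe.coe => norm_cast; constructor <;> intro <;> linarith
    all_goals simp [← EReal.coe_sub]
  have hle := hv d
  rw [conj_eq_of_mem_subdiff hd, inner_sub_right, real_inner_comm d, real_inner_comm u] at hle
  exact (key _ _ _ _).1 hle

theorem isStronglyConvex_zero_conj : IsStronglyConvex 0 (conj h) := by
  intro x u r s a b hx hu ha hb hab
  refine iSup_le fun z => ?_
  have hx' := (inner_sub_le_conj x z).trans hx
  have hu' := (inner_sub_le_conj u z).trans hu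
  induction hz : h z with
  | bot => simp [hz] at hx'
  | top => simp
  | coe t =>
    rw [hz, ← EReal.coe_sub, EReal.coe_le_coe_iff] at hx' hu'
    rw [← EReal.coe_sub, EReal.coe_le_coe_iff, inner_add_left, real_inner_smul_left,
      real_inner_smul_left]
    calc a * inner ℝ x z + b * inner ℝ u z - t
        = a * (inner ℝ x z - t) + b * (inner ℝ u z - t) := by linear_combination t * hab
      _ ≤ a * r + b * s := by gcongr
      _ = _ := by ring

theorem hasGradientAt_of_subgradient [CompleteSpace H] {φ : H → ℝ} {X : H → H}
    (hφ : ∀ v, φ w + inner ℝ (X w) (v - w) ≤ φ v) (hφ' : ∀ v, φ v + inner ℝ (X v) (w - v) ≤ φ w)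
    (hX : ContinuousAt X w) : HasGradientAt φ (X w) w := by
  rw [hasGradientAt_iff_isLittleO, Asymptotics.isLittleO_iff]
  intro ε hε
  filter_upwards [Metric.continuousAt_iff'.1 hX ε hε] with v hv
  rw [Real.norm_of_nonneg (by linarith [hφ v])]
  calc φ v - φ w - inner ℝ (X w) (v - w)
      ≤ inner ℝ (X v - X w) (v - w) := by
        rw [inner_sub_left]
        have := hφ' v
        rw [← neg_sub v w, inner_neg_right] at this
        linarith
    _ ≤ ‖X v - X w‖ * ‖v - w‖ := real_inner_le_norm _ _
    _ ≤ ε * ‖v - w‖ := by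
        gcongr
        exact (dist_eq_norm (X v) (X w) ▸ hv).le

theorem neg_mem_subdiff_conj_of_mem_subdiff_dualG (hd : d ∈ subdiff (dualG h) x) :
    -d ∈ subdiff (conj h) (-x) := by
  intro u
  have hle := hd (-u)
  rw [dualG, dualG, neg_neg] at hle
  rwa [show inner ℝ d (-u - x) = inner ℝ (-d) (u - -x) by
    rw [inner_neg_left, ← inner_neg_right]; congr 1; abel] at hle

theorem isStronglyConvex_zero_dualG : IsStronglyConvex 0 (dualG h) := by
  intro x u r s a b hx hu ha hb hab
  have hle := isStronglyConvex_zero_conj (-x) (-u) r s a b hx hu ha hb hab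
  rw [smul_neg, smul_neg, ← neg_add, ← neg_sub', norm_neg] at hle
  exact hle

theorem isProper_dualG (hh : IsProper h) (hd : d ∈ subdiff h v) : IsProper (dualG h) :=
  ⟨fun _ => (hh.conj hd).1 _, -d, by
    rw [dualG, neg_neg]
    exact (hh.conj hd).ne_top_of_mem_subdiff (mem_subdiff_conj hd)⟩

end ConvexFunctions

theorem isEVIStep_toReal {H : Type*} [SeminormedAddCommGroup H] {h : H → EReal} {l : ℝ} {w p : H}
    (hh : IsProper h) (hl : 0 < l)
    (hstep : ∀ z, h p + ((l / 2 * ‖p - z‖ ^ 2 : ℝ) : EReal) ≤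
      h z + ((l / 2 * ‖w - z‖ ^ 2 : ℝ) : EReal)) :
    IsEVIStep (fun z => (h z).toReal) {z | h z ≠ ⊤} l⁻¹ w p := by
  have hp : h p ≠ ⊤ := by
    obtain ⟨z, hz⟩ := hh.2
    intro hp
    have hle := hstep z
    rw [hp, EReal.top_add_coe] at hle
    exact EReal.add_ne_top hz (EReal.coe_ne_top _) (top_le_iff.1 hle)
  refine ⟨hp, fun z hz => ?_⟩
  obtain ⟨r, hr⟩ := hh.exists_eq_coe hp
  obtain ⟨s, hs⟩ := hh.exists_eq_coe hz
  have hle := hstep z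
  rw [hr, hs, ← EReal.coe_add, ← EReal.coe_add, EReal.coe_le_coe_iff] at hle
  simp only [hr, hs, EReal.toReal_coe, dist_eq_norm]
  refine le_of_mul_le_mul_left ?_ hl
  rw [mul_add, show l * (2 * l⁻¹ * (r - s)) = 2 * (r - s) by field_simp]
  linarith

section DualProblem

variable {E V : Type*} [NormedAddCommGroup E] [InnerProductSpace ℝ E] [NormedAddCommGroup V]
  [InnerProductSpace ℝ V] {f : E → EReal} {g : V → EReal} {A : E →L[ℝ] V}
  {σ l B B' : ℝ} {x x' : E} {y w p v d d' ystar : V}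

theorem dualFun_le_primalObj (x : E) (y : V) : dualFun f g A y ≤ primalObj f g A x := by
  have hle : dualFun f g A y ≤ f x + g (A x) - ((inner ℝ y (A x - A x) : ℝ) : EReal) :=
    iInf₂_le (f := fun x z => f x + g z - ((inner ℝ y (A x - z) : ℝ) : EReal)) x (A x)
  simpa [primalObj] using hle

theorem norm_le_gammaG (hb : BoundedSubgradients g) (hd : d ∈ subdiff g v) : ‖d‖ ≤ gammaG g :=
  le_csSup hb.2 ⟨v, d, hd, rfl⟩

theorem gammaG_nonneg (g : V → EReal) : 0 ≤ gammaG g :=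
  Real.sSup_nonneg <| by
    rintro _ ⟨_, d, _, rfl⟩
    exact norm_nonneg d

variable [CompleteSpace E] [CompleteSpace V]

theorem isPrimalPoint_iff_mem_subdiff : IsPrimalPoint f A y x ↔ adjoint A y ∈ subdiff f x :=
  isMaxOn_inner_sub_iff

theorem existsUnique_isPrimalPoint (hσ : 0 < σ) (hf : IsProper f) (hlsc : LowerSemicontinuous f)
    (hconv : IsStronglyConvex σ f) (A : E →L[ℝ] V) (y : V) : ∃! x, IsPrimalPoint f A y x := by
  simp only [isPrimalPoint_iff_mem_subdiff]
  obtain ⟨x, hx⟩ := hconv.exists_mem_subdiff hσ hf hlsc (adjoint A y)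
  exact ⟨x, hx, fun x' hx' => hconv.eq_of_mem_subdiff hσ hf hx' hx⟩

theorem IsPrimalPoint.map_mem_subdiff_dualF (hx : IsPrimalPoint f A y x) :
    A x ∈ subdiff (dualF f A) y := by
  intro w
  simpa only [dualF, ← adjoint_inner_left, map_sub, real_inner_comm] using
    mem_subdiff_conj (isPrimalPoint_iff_mem_subdiff.1 hx) (adjoint A w)

theorem IsPrimalPoint.dualF_eq (hx : IsPrimalPoint f A y x) :
    dualF f A y = ((inner ℝ y (A x) : ℝ) : EReal) - f x := by
  rw [dualF, conj_eq_of_mem_subdiff (isPrimalPoint_iff_mem_subdiff.1 hx), adjoint_inner_left]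

theorem IsPrimalPoint.norm_map_sub_map_le (hσ : 0 < σ) (hf : IsProper f)
    (hconv : IsStronglyConvex σ f) (hx : IsPrimalPoint f A y x) (hx' : IsPrimalPoint f A w x') :
    ‖A x - A x'‖ ≤ lipF A σ * ‖y - w‖ := by
  have hle : σ * ‖x - x'‖ ≤ ‖A‖ * ‖y - w‖ :=
    calc σ * ‖x - x'‖ ≤ ‖adjoint A y - adjoint A w‖ :=
          hconv.mul_norm_sub_le hf (isPrimalPoint_iff_mem_subdiff.1 hx)
            (isPrimalPoint_iff_mem_subdiff.1 hx')
      _ ≤ ‖adjoint A‖ * ‖y - w‖ := by rw [← map_sub]; exact le_opNorm _ _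
      _ = ‖A‖ * ‖y - w‖ := by rw [LinearIsometryEquiv.norm_map]
  calc ‖A x - A x'‖ ≤ ‖A‖ * ‖x - x'‖ := by rw [← map_sub]; exact le_opNorm _ _
    _ ≤ ‖A‖ * (‖A‖ * ‖y - w‖ / σ) := by gcongr; rwa [le_div_iff₀ hσ, mul_comm]
    _ = lipF A σ * ‖y - w‖ := by rw [lipF]; ring

theorem isProper_dualF (hσ : 0 < σ) (hf : IsProper f) (hlsc : LowerSemicontinuous f)
    (hconv : IsStronglyConvex σ f) (A : E →L[ℝ] V) : IsProper (dualF f A) := by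
  obtain ⟨x, hx, -⟩ := existsUnique_isPrimalPoint hσ hf hlsc hconv A 0
  have hx := isPrimalPoint_iff_mem_subdiff.1 hx
  exact ⟨fun _ => conj_ne_bot hf.2 _, 0, (hf.conj hx).ne_top_of_mem_subdiff (mem_subdiff_conj hx)⟩

theorem gradF_eq_map (hσ : 0 < σ) (hf : IsProper f) (hlsc : LowerSemicontinuous f)
    (hconv : IsStronglyConvex σ f) (hx : IsPrimalPoint f A y x) : gradF f A y = A x := by
  choose X hX _ using existsUnique_isPrimalPoint hσ hf hlsc hconv A
  have hsub (u v : V) :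
      (dualF f A u).toReal + inner ℝ (A (X u)) (v - u) ≤ (dualF f A v).toReal := by
    have hF := isProper_dualF hσ hf hlsc hconv A
    obtain ⟨r, hr⟩ := hF.exists_eq_coe_of_mem_subdiff (hX u).map_mem_subdiff_dualF
    obtain ⟨s, hs⟩ := hF.exists_eq_coe_of_mem_subdiff (hX v).map_mem_subdiff_dualF
    have hle := (hX u).map_mem_subdiff_dualF v
    rw [hr, hs, ← EReal.coe_add, EReal.coe_le_coe_iff] at hle
    simpa [hr, hs] using hle
  have hcont : ContinuousAt (fun z => A (X z)) y := by
    have hlip : LipschitzWith (lipF A σ).toNNReal fun z => A (X z) :=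
      .of_dist_le' fun u v => by
        simpa only [dist_eq_norm] using (hX u).norm_map_sub_map_le hσ hf hconv (hX v)
    exact hlip.continuous.continuousAt
  rw [(existsUnique_isPrimalPoint hσ hf hlsc hconv A y).unique hx (hX y)]
  exact (hasGradientAt_of_subgradient (hsub y) (fun v => hsub v y) hcont).gradient

theorem gradF_mem_subdiff_dualF (hσ : 0 < σ) (hf : IsProper f) (hlsc : LowerSemicontinuous f)
    (hconv : IsStronglyConvex σ f) (A : E →L[ℝ] V) (y : V) :
    gradF f A y ∈ subdiff (dualF f A) y := by
  obtain ⟨x, hx, -⟩ := existsUnique_isPrimalPoint hσ hf hlsc hconv A y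
  exact gradF_eq_map hσ hf hlsc hconv hx ▸ hx.map_mem_subdiff_dualF

theorem isProper_dualObj (hF : IsProper (dualF f A))
    (hgrad : ∀ w, gradF f A w ∈ subdiff (dualF f A) w) (hG : IsProper (dualG g)) :
    IsProper (dualObj f g A) := by
  refine ⟨fun y => by simp [dualObj, EReal.add_eq_bot_iff, hF.1, hG.1], ?_⟩
  obtain ⟨y, hy⟩ := hG.2
  exact ⟨y, EReal.add_ne_top (hF.ne_top_of_mem_subdiff (hgrad y)) hy⟩

theorem dualFun_eq_neg_dualObj (hf : IsProper f) (hg : IsProper g) (y : V) :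
    dualFun f g A y = -dualObj f g A y := by
  have key (a b : EReal) (ha : a ≠ ⊥) (hb : b ≠ ⊥) (r s : ℝ) :
      a + b - ((r - s : ℝ) : EReal) = -((r - a) + (((-s : ℝ) : EReal) - b)) := by
    induction a <;> induction b
    case coe.coe => norm_cast; ring
    all_goals simp_all [← EReal.coe_sub]
  have hterm (x : E) (z : V) : f x + g z - ((inner ℝ y (A x - z) : ℝ) : EReal) =
      -((((inner ℝ (adjoint A y) x : ℝ) : EReal) - f x) +
        (((inner ℝ (-y) z : ℝ) : EReal) - g z)) := by
    rw [adjoint_inner_left, inner_neg_left, inner_sub_right]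
    exact key _ _ (hf.1 x) (hg.1 z) _ _
  simp only [dualFun, hterm]
  refine le_antisymm (EReal.le_neg_of_le_neg ?_) (le_iInf₂ fun x z => ?_)
  · refine EReal.add_le_of_forall_lt fun a ha b hb => EReal.le_neg_of_le_neg ?_
    obtain ⟨x, hx⟩ := lt_iSup_iff.1 ha
    obtain ⟨z, hz⟩ := lt_iSup_iff.1 hb
    exact (iInf₂_le x z).trans (EReal.neg_le_neg_iff.2 (add_le_add hx.le hz.le))
  · exact EReal.neg_le_neg_iff.2 (add_le_add (inner_sub_le_conj _ x) (inner_sub_le_conj _ z))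

theorem isMinOn_dualObj (hf : IsProper f) (hg : IsProper g)
    (hmax : IsMaxOn (dualFun f g A) univ ystar) : IsMinOn (dualObj f g A) univ ystar := by
  intro y hy
  have hle := hmax hy
  simp only [mem_ofPred_eq, dualFun_eq_neg_dualObj hf hg, EReal.neg_le_neg_iff] at hle
  exact hle

theorem IsProxGrad.neg_mem_subdiff_dualG {φ : ℝ} (hφ : dualF f A w = φ)
    (h : IsProxGrad f g A l w p) : -(gradF f A w + l • (p - w)) ∈ subdiff (dualG g) p := by
  have hgrad : HasGradientAt
      (fun y => φ + (inner ℝ (y - w) (gradF f A w) + l / 2 * ‖y - w‖ ^ 2))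
      (gradF f A w + l • (p - w)) p := by
    rw [hasGradientAt_iff_hasFDerivAt]
    have hsub := (hasFDerivAt_id (𝕜 := ℝ) p).sub_const w
    refine (((hsub.inner ℝ (hasFDerivAt_const (gradF f A w) p)).add
      (hsub.norm_sq.const_mul (l / 2))).const_add φ).congr_fderiv ?_
    ext z
    simp [real_inner_comm]
    ring
  refine isStronglyConvex_zero_dualG.neg_mem_subdiff_of_isMinOn_add hgrad ?_
  simpa only [IsProxGrad, quadModel, hφ, add_comm, EReal.coe_add] using h

theorem IsAcceptedStep.dualObj_add_le {φ : ℝ} (hφ : dualF f A w = φ)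
    (hgrad : gradF f A w ∈ subdiff (dualF f A) w) (h : IsAcceptedStep f g A l w p) (y : V) :
    dualObj f g A p + ((l / 2 * ‖p - y‖ ^ 2 : ℝ) : EReal) ≤
      dualObj f g A y + ((l / 2 * ‖w - y‖ ^ 2 : ℝ) : EReal) := by
  have hF : ((φ + inner ℝ (gradF f A w) (y - w) : ℝ) : EReal) ≤ dualF f A y := by
    simpa only [hφ, EReal.coe_add] using hgrad y
  have hG := h.1.neg_mem_subdiff_dualG hφ y
  have hexpand : inner ℝ (p - w) (gradF f A w) + l / 2 * ‖p - w‖ ^ 2 + l / 2 * ‖p - y‖ ^ 2 =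
      inner ℝ (gradF f A w) (y - w) + inner ℝ (-(gradF f A w + l • (p - w))) (y - p) +
        l / 2 * ‖w - y‖ ^ 2 := by
    rw [show w - y = (p - y) - (p - w) by abel, norm_sub_sq_real (p - y),
      show y - p = -(p - y) by abel, show y - w = (p - w) - (p - y) by abel, inner_neg_neg,
      inner_add_left, inner_sub_right, real_inner_smul_left, real_inner_comm (p - w) (p - y),
      real_inner_comm (p - w) (gradF f A w)]
    ring
  calc dualObj f g A p + ((l / 2 * ‖p - y‖ ^ 2 : ℝ) : EReal)
      ≤ quadModel f g A l p w + ((l / 2 * ‖p - y‖ ^ 2 : ℝ) : EReal) := add_le_add_left h.2 _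
    _ = ((φ + inner ℝ (gradF f A w) (y - w) : ℝ) : EReal) +
          (dualG g p + ((inner ℝ (-(gradF f A w + l • (p - w))) (y - p) : ℝ) : EReal)) +
          ((l / 2 * ‖w - y‖ ^ 2 : ℝ) : EReal) := by
        rw [quadModel, hφ]
        induction dualG g p
        case coe c => norm_cast; linear_combination hexpand
        all_goals
          simp only [← EReal.coe_add, EReal.coe_add_top, EReal.top_add_coe, EReal.add_bot,
            EReal.bot_add]
    _ ≤ dualObj f g A y + ((l / 2 * ‖w - y‖ ^ 2 : ℝ) : EReal) :=
        add_le_add_left (add_le_add hF hG) _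

theorem IsAcceptedStep.isEVIStep (hF : IsProper (dualF f A))
    (hgrad : ∀ w, gradF f A w ∈ subdiff (dualF f A) w) (hG : IsProper (dualG g)) (hl : 0 < l)
    (h : IsAcceptedStep f g A l w p) :
    IsEVIStep (fun z => (dualObj f g A z).toReal) {z | dualObj f g A z ≠ ⊤} l⁻¹ w p :=
  have ⟨_, hφ⟩ := hF.exists_eq_coe_of_mem_subdiff (hgrad w)
  isEVIStep_toReal (isProper_dualObj hF hgrad hG) hl (h.dualObj_add_le hφ (hgrad w))

theorem IsPrimalPoint.primalObj_sub_dualFun_le (hf : IsProper f) (hg : IsProper g)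
    (hx : IsPrimalPoint f A p x) (hd : d ∈ subdiff g (A x)) (hd' : d' ∈ subdiff g v)
    (hv : -v ∈ subdiff (dualG g) p) :
    primalObj f g A x - dualFun f g A p ≤ ((inner ℝ (p + d) (A x - v) : ℝ) : EReal) := by
  obtain ⟨r, hr⟩ := hf.exists_eq_coe_of_mem_subdiff (isPrimalPoint_iff_mem_subdiff.1 hx)
  obtain ⟨s, hs⟩ := hg.exists_eq_coe_of_mem_subdiff hd
  obtain ⟨t, ht⟩ := hg.exists_eq_coe_of_mem_subdiff hd'
  obtain ⟨γ, hγ⟩ := (isProper_dualG hg hd').exists_eq_coe_of_mem_subdiff hv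
  have hsub : s + inner ℝ d (v - A x) ≤ t := by
    simpa only [hs, ht, ← EReal.coe_add, EReal.coe_le_coe_iff] using hd v
  have hfenchel : γ + t ≤ inner ℝ (-p) v := by
    have hle := conj_add_le_of_mem_subdiff hd' (u := -p)
      (by simpa using neg_mem_subdiff_conj_of_mem_subdiff_dualG hv)
    rwa [← dualG, hγ, ht, ← EReal.coe_add, EReal.coe_le_coe_iff] at hle
  rw [dualFun_eq_neg_dualObj hf hg, dualObj, hx.dualF_eq, primalObj, hr, hs, hγ]
  norm_cast
  rw [inner_sub_right] at hsub
  rw [inner_neg_left] at hfenchel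
  rw [inner_add_left, inner_sub_right, inner_sub_right]
  linarith

theorem GapLE.mono (h : GapLE f g A p B) (hB : B ≤ B') : GapLE f g A p B' :=
  have hB' := EReal.coe_le_coe_iff.2 hB
  ⟨h.1, fun x hx => ⟨(h.2 x hx).1.trans hB', fun xs hxs => ((h.2 x hx).2 xs hxs).trans hB'⟩⟩

theorem IsProxGrad.gapLE (hσ : 0 < σ) (hf : IsProper f) (hlsc : LowerSemicontinuous f)
    (hconv : IsStronglyConvex σ f) (hg : IsProper g) (hb : BoundedSubgradients g) (hl : 0 ≤ l)
    (h : IsProxGrad f g A l w p) :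
    GapLE f g A p ((l + lipF A σ) * (‖p‖ + gammaG g) * ‖p - w‖) := by
  refine ⟨existsUnique_isPrimalPoint hσ hf hlsc hconv A p, fun x hx => ?_⟩
  obtain ⟨xw, hxw, -⟩ := existsUnique_isPrimalPoint hσ hf hlsc hconv A w
  obtain ⟨_, hφ⟩ := (isProper_dualF hσ hf hlsc hconv A).exists_eq_coe_of_mem_subdiff
    hxw.map_mem_subdiff_dualF
  have hv := h.neg_mem_subdiff_dualG hφ
  rw [gradF_eq_map hσ hf hlsc hconv hxw] at hv
  obtain ⟨d, hd⟩ := hb.1 (A x)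
  obtain ⟨d', hd'⟩ := hb.1 (A xw + l • (p - w))
  have hres : ‖A x - (A xw + l • (p - w))‖ ≤ (l + lipF A σ) * ‖p - w‖ :=
    calc ‖A x - (A xw + l • (p - w))‖ = ‖(A x - A xw) - l • (p - w)‖ := by rw [sub_sub]
      _ ≤ ‖A x - A xw‖ + ‖l • (p - w)‖ := norm_sub_le _ _
      _ ≤ lipF A σ * ‖p - w‖ + l * ‖p - w‖ := by
        rw [norm_smul, Real.norm_of_nonneg hl]
        gcongr
        exact hx.norm_map_sub_map_le hσ hf hconv hxw
      _ = (l + lipF A σ) * ‖p - w‖ := by ring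
  have hgap : primalObj f g A x - dualFun f g A p ≤
      (((l + lipF A σ) * (‖p‖ + gammaG g) * ‖p - w‖ : ℝ) : EReal) := by
    refine (hx.primalObj_sub_dualFun_le hf hg hd hd' hv).trans (EReal.coe_le_coe_iff.2 ?_)
    calc inner ℝ (p + d) (A x - (A xw + l • (p - w)))
        ≤ ‖p + d‖ * ‖A x - (A xw + l • (p - w))‖ := real_inner_le_norm _ _
      _ ≤ (‖p‖ + gammaG g) * ((l + lipF A σ) * ‖p - w‖) := by
        gcongr
        · exact add_nonneg (norm_nonneg p) (gammaG_nonneg g)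
        · exact (norm_add_le p d).trans (by gcongr; exact norm_le_gammaG hb hd)
      _ = (l + lipF A σ) * (‖p‖ + gammaG g) * ‖p - w‖ := by ring
  exact ⟨hgap, fun xstar _ =>
    (EReal.sub_le_sub le_rfl (dualFun_le_primalObj xstar p)).trans hgap⟩

theorem IsAcceptedStep.gapLE_gapBound (hσ : 0 < σ) (hf : IsProper f)
    (hlsc : LowerSemicontinuous f) (hconv : IsStronglyConvex σ f) (hg : IsProper g)
    (hb : BoundedSubgradients g) (hmin : IsMinOn (dualObj f g A) univ ystar) (hl : 0 < l)
    (h : IsAcceptedStep f g A l w p) {y₀ : V} {k : ℕ} (hw : ‖w - ystar‖ ≤ ‖y₀ - ystar‖)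
    (hpw : ‖p - w‖ ≤ 2 * ‖y₀ - ystar‖ / k) : GapLE f g A p (gapBound g A σ l y₀ ystar k) := by
  obtain ⟨d, hd⟩ := hb.1 0
  have hF := isProper_dualF hσ hf hlsc hconv A
  have hgrad := gradF_mem_subdiff_dualF hσ hf hlsc hconv A
  have hG := isProper_dualG hg hd
  obtain ⟨hystar, hmin⟩ := (isProper_dualObj hF hgrad hG).isMinOn_toReal hmin
  have hp : ‖p - ystar‖ ≤ ‖w - ystar‖ := by
    simpa only [dist_eq_norm] using
      (h.isEVIStep hF hgrad hG hl).dist_le (inv_nonneg.2 hl.le) hystar hmin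
  have hnorm : ‖p‖ ≤ ‖y₀ - ystar‖ + ‖ystar‖ := by
    linarith [norm_le_norm_sub_add p ystar]
  refine (h.1.gapLE hσ hf hlsc hconv hg hb hl.le).mono ?_
  have hlipF : 0 ≤ lipF A σ := by unfold lipF; positivity
  have hγ := gammaG_nonneg g
  unfold gapBound
  gcongr

section Methods

variable {L : ℕ → ℝ} {y w : ℕ → V} {t : ℕ → ℝ} {k : ℕ}

theorem antitone_inv_of_le_succ (hL0 : 0 < L 0) (hL : ∀ k, L k ≤ L (k + 1)) :
    Antitone fun k => (L (k + 1))⁻¹ := fun i _ hij =>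
  inv_anti₀ (hL0.trans_le (monotone_nat_of_le_succ hL (Nat.zero_le (i + 1))))
    (monotone_nat_of_le_succ hL (Nat.succ_le_succ hij))

theorem IsDPG.pos (h : IsDPG f g A L y) (k : ℕ) : 0 < L k :=
  h.L_pos.trans_le (monotone_nat_of_le_succ h.L_mono k.zero_le)

theorem IsFDPG.pos (h : IsFDPG f g A L y w t) (k : ℕ) : 0 < L k :=
  h.L_pos.trans_le (monotone_nat_of_le_succ h.L_mono k.zero_le)

theorem IsDPG.norm_sub_le (hF : IsProper (dualF f A))
    (hgrad : ∀ w, gradF f A w ∈ subdiff (dualF f A) w) (hG : IsProper (dualG g))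
    (hmin : IsMinOn (dualObj f g A) univ ystar) (h : IsDPG f g A L y) (k : ℕ) :
    ‖y k - ystar‖ ≤ ‖y 0 - ystar‖ := by
  obtain ⟨hystar, hmin⟩ := (isProper_dualObj hF hgrad hG).isMinOn_toReal hmin
  simpa only [dist_eq_norm] using dist_le_dist_zero
    (fun i => (inv_pos.2 (h.pos (i + 1))).le)
    (fun i _ => (h.step i).isEVIStep hF hgrad hG (h.pos _)) hystar hmin

theorem IsDPG.norm_next_sub_le (hF : IsProper (dualF f A))
    (hgrad : ∀ w, gradF f A w ∈ subdiff (dualF f A) w) (hG : IsProper (dualG g))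
    (hmin : IsMinOn (dualObj f g A) univ ystar) (h : IsDPG f g A L y) (hk : 1 ≤ k)
    (hl : L k ≤ l) (hp : IsAcceptedStep f g A l (y k) p) :
    ‖p - y k‖ ≤ 2 * ‖y 0 - ystar‖ / k := by
  obtain ⟨hystar, hmin⟩ := (isProper_dualObj hF hgrad hG).isMinOn_toReal hmin
  have hl0 := (h.pos k).trans_le hl
  have hinv_le (i : ℕ) (hi : i < k) : l⁻¹ ≤ (L (i + 1))⁻¹ :=
    inv_anti₀ (h.pos _) ((monotone_nat_of_le_succ h.L_mono hi).trans hl)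
  rw [norm_sub_rev]
  simpa only [dist_eq_norm] using dist_le_two_mul_dist_div
    (antitone_inv_of_le_succ h.L_pos h.L_mono) (inv_pos.2 hl0) hinv_le hk
    (fun i _ => (h.step i).isEVIStep hF hgrad hG (h.pos _)) (hp.isEVIStep hF hgrad hG hl0)
    hystar hmin

theorem IsFDPG.isAccelerated (hF : IsProper (dualF f A))
    (hgrad : ∀ w, gradF f A w ∈ subdiff (dualF f A) w) (hG : IsProper (dualG g))
    (h : IsFDPG f g A L y w t) :
    IsAccelerated (fun z => (dualObj f g A z).toReal) {z | dualObj f g A z ≠ ⊤}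
      (fun k => (L (k + 1))⁻¹) y w t where
  w_zero := h.w_zero
  t_zero := h.t_zero
  step k := (h.step k).isEVIStep hF hgrad hG (h.pos _)
  t_succ := h.t_succ
  w_succ := h.w_succ

theorem IsFDPG.norm_sub_le (hF : IsProper (dualF f A))
    (hgrad : ∀ w, gradF f A w ∈ subdiff (dualF f A) w) (hG : IsProper (dualG g))
    (hmin : IsMinOn (dualObj f g A) univ ystar) (h : IsFDPG f g A L y w t) (k : ℕ) :
    ‖y k - ystar‖ ≤ ‖y 0 - ystar‖ := by
  obtain ⟨hystar, hmin⟩ := (isProper_dualObj hF hgrad hG).isMinOn_toReal hmin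
  exact (h.isAccelerated hF hgrad hG).norm_sub_le (antitone_inv_of_le_succ h.L_pos h.L_mono)
    (fun i => (inv_pos.2 (h.pos (i + 1))).le) hystar hmin k

theorem IsFDPG.norm_next_sub_le (hF : IsProper (dualF f A))
    (hgrad : ∀ w, gradF f A w ∈ subdiff (dualF f A) w) (hG : IsProper (dualG g))
    (hmin : IsMinOn (dualObj f g A) univ ystar) (h : IsFDPG f g A L y w t) (hk : 1 ≤ k)
    (hl : L k ≤ l) (hp : IsAcceptedStep f g A l (y k) p) :
    ‖p - y k‖ ≤ 2 * ‖y 0 - ystar‖ / k := by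
  obtain ⟨hystar, hmin⟩ := (isProper_dualObj hF hgrad hG).isMinOn_toReal hmin
  have hl0 := (h.pos k).trans_le hl
  obtain ⟨j, rfl⟩ := Nat.exists_eq_add_of_le' hk
  have hacc := h.isAccelerated hF hgrad hG
  have hmove : t j * ‖p - y (j + 1)‖ ≤ ‖y 0 - ystar‖ :=
    hacc.momentum_mul_norm_sub_le (antitone_inv_of_le_succ h.L_pos h.L_mono) hystar hmin
      (inv_pos.2 hl0).le (inv_anti₀ (h.pos _) hl) (hp.isEVIStep hF hgrad hG hl0)
  have hmomentum : ((j + 1 : ℕ) : ℝ) / 2 ≤ t j := by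
    push_cast
    linarith [hacc.add_two_div_two_le_momentum j]
  rw [le_div_iff₀ (by positivity)]
  linarith [mul_le_mul_of_nonneg_right hmomentum (norm_nonneg (p - y (j + 1)))]

end Methods

end DualProblem

end DualProx

theorem mainTheorem5_general
    {E V : Type*} [NormedAddCommGroup E] [InnerProductSpace ℝ E] [CompleteSpace E]
    [NormedAddCommGroup V] [InnerProductSpace ℝ V] [CompleteSpace V]
    (f : E → EReal) (g : V → EReal) (A : E →L[ℝ] V) (σ : ℝ) (hσ : 0 < σ)
    (hf_proper : DualProx.IsProper f) (hf_closed : LowerSemicontinuous f)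
    (hf_conv : DualProx.IsStronglyConvex σ f)
    (hg_proper : DualProx.IsProper g) (hg_subgrad : DualProx.BoundedSubgradients g)
    (ystar : V) (hystar : IsMaxOn (DualProx.dualFun f g A) Set.univ ystar)
    (L : ℕ → ℝ) (y : ℕ → V)
    (hy : DualProx.IsDPG f g A L y ∨ ∃ w t, DualProx.IsFDPG f g A L y w t) :
    (∀ k : ℕ, 1 ≤ k → ∀ (L' : ℝ) (p : V), L k ≤ L' →
      DualProx.IsAcceptedStep f g A L' (y k) p →
      DualProx.GapLE f g A p (DualProx.gapBound g A σ L' (y 0) ystar k)) ∧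
    (DualProx.IsDPG f g A L y → ∀ k : ℕ, 1 ≤ k →
      DualProx.GapLE f g A (y (k + 1))
        (DualProx.gapBound g A σ (L (k + 1)) (y 0) ystar k)) := by
  obtain ⟨d, hd⟩ := hg_subgrad.1 0
  have hF := DualProx.isProper_dualF hσ hf_proper hf_closed hf_conv A
  have hgrad := DualProx.gradF_mem_subdiff_dualF hσ hf_proper hf_closed hf_conv A
  have hG := DualProx.isProper_dualG hg_proper hd
  have hmin := DualProx.isMinOn_dualObj hf_proper hg_proper hystar
  have extra_step (k : ℕ) (hk : 1 ≤ k) (L' : ℝ) (p : V) (hL' : L k ≤ L')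
      (hp : DualProx.IsAcceptedStep f g A L' (y k) p) :
      DualProx.GapLE f g A p (DualProx.gapBound g A σ L' (y 0) ystar k) := by
    obtain ⟨hpos, hdist, hmove⟩ :
        0 < L k ∧ ‖y k - ystar‖ ≤ ‖y 0 - ystar‖ ∧ ‖p - y k‖ ≤ 2 * ‖y 0 - ystar‖ / k := by
      rcases hy with h | ⟨w, t, h⟩ <;>
      exact ⟨h.pos k, h.norm_sub_le hF hgrad hG hmin k,
        h.norm_next_sub_le hF hgrad hG hmin hk hL' hp⟩
    exact hp.gapLE_gapBound hσ hf_proper hf_closed hf_conv hg_proper hg_subgrad hmin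
      (hpos.trans_le hL') hdist hmove
  exact ⟨extra_step, fun h k hk => extra_step k hk _ _ (h.L_mono k) (h.step k)⟩

theorem mainTheorem5
    {E V : Type*} [NormedAddCommGroup E] [InnerProductSpace ℝ E] [FiniteDimensional ℝ E]
    [CompleteSpace E]
    [NormedAddCommGroup V] [InnerProductSpace ℝ V] [FiniteDimensional ℝ V] [CompleteSpace V]
    (f : E → EReal) (g : V → EReal) (A : E →L[ℝ] V) (σ : ℝ) (hσ : 0 < σ)
    (hf_proper : DualProx.IsProper f) (hf_closed : LowerSemicontinuous f)
    (hf_conv : DualProx.IsStronglyConvex σ f)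
    (hg_proper : DualProx.IsProper g) (hg_closed : LowerSemicontinuous g)
    (hg_conv : DualProx.IsStronglyConvex 0 g)
    (hg_subgrad : DualProx.BoundedSubgradients g)
    (ystar : V) (hystar : IsMaxOn (DualProx.dualFun f g A) Set.univ ystar)
    (L : ℕ → ℝ) (y : ℕ → V)
    (hy : DualProx.IsDPG f g A L y ∨ ∃ w t, DualProx.IsFDPG f g A L y w t) :
    (∀ k : ℕ, 1 ≤ k → ∀ (L' : ℝ) (p : V), L k ≤ L' →
      DualProx.IsAcceptedStep f g A L' (y k) p →
      DualProx.GapLE f g A p (DualProx.gapBound g A σ L' (y 0) ystar k)) ∧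
    (DualProx.IsDPG f g A L y → ∀ k : ℕ, 1 ≤ k →
      DualProx.GapLE f g A (y (k + 1))
        (DualProx.gapBound g A σ (L (k + 1)) (y 0) ystar k)) :=
  mainTheorem5_general f g A σ hσ hf_proper hf_closed hf_conv hg_proper hg_subgrad ystar
    hystar L y hy
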